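/- A weighted oriented graph $D=(G,\mathcal O,w)$ consists of a finite simple graph $G$ with vertex set $V$, an orientation $\mathcal O$ of the edges of $G$ (each edge $\{x,y\}$ is given exactly one of the two directions $(x,y)$, $(y,x)$; the set of oriented edges is $E(D)$), and a weight function $w:V\to\{1,2,3,\dots\}$. Put $V^+=\{x\in V: w(x)>1\}$, $N_D^+(x)=\{y:(x,y)\in E(D)\}$, $N_D^-(x)=\{y:(y,x)\in E(D)\}$ and $N_D(x)=N_D^+(x)\cup N_D^-(x)$. Assume that every source (a vertex $x$ with $N_D^-(x)=\emptyset$) has weight $w(x)=1$. For a field $K$, the edge ideal of $D$ is the ideal $I(D)$ of the polynomial ring $K[x : x\in V]$ generated by the monomials $x\,y^{w(y)}$ with $(x,y)\in E(D)$. An ideal is unmixed if all its associated primes have the same height. A graph is well-covered if all its maximal (with respect to inclusion) stable sets have cardinality $\beta(G)$, the maximum cardinality of a stable set. **Theorem.** Let $D=(G,\mathcal O,w)$ be a weighted oriented graph as above such that $G$ has no cycle of length $3$ and no cycle of length $5$. Then $I(D)$ is unmixed if and only if both of the following conditions hold: (a) $G$ is well-covered. (b) For every $(y,x)\in E(D)$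 with $y\in V^+$, there is $y'\in N_D(x)\setminus\{y\}$ such that $N_D(y')\subseteq N_D^+(y)$. -/

import Mathlib

/-- A weighted oriented graph `D = (G, 𝒪, w)`: a simple graph `G`, an orientation of `G`
(each edge of `G` gets exactly one of its two directions) and positive integer vertex weights.
`D.Edge x y` says that the ordered pair `(x, y)` is an oriented edge of `D`. -/
structure WeightedOrientedGraph (V : Type*) where
  /-- the underlying graph -/
  G : SimpleGraph V
  /-- the oriented edges -/
  Edge : V → V → Prop
  adj_iff : ∀ x y, G.Adj x y ↔ Edge x y ∨ Edge y x
  asymm : ∀ x y, Edge x y → ¬ Edge y x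
  /-- the weight function -/
  w : V → ℕ
  one_le_w : ∀ x, 1 ≤ w x

namespace WeightedOrientedGraph

variable {V : Type*} (D : WeightedOrientedGraph V)

/-- The set `V⁺` of vertices of weight greater than one. -/
def Vplus : Set V := {x | 1 < D.w x}

/-- The out-neighbourhood of a vertex. -/
def outNbhd (x : V) : Set V := {y | D.Edge x y}

/-- The in-neighbourhood of a vertex. -/
def inNbhd (x : V) : Set V := {y | D.Edge y x}

/-- The neighbourhood of a vertex. -/
def nbhd (x : V) : Set V := D.outNbhd x ∪ D.inNbhd x

/-- A source is a vertex without in-neighbours (so isolated vertices are sources). -/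
def IsSource (x : V) : Prop := D.inNbhd x = ∅

/-- The edge ideal `I(D)`, generated by the monomials `x_i * x_j ^ w(x_j)` for `(x_i, x_j)`
an oriented edge of `D`, in the polynomial ring over `K` with one variable per vertex. -/
noncomputable def edgeIdeal (K : Type*) [Field K] : Ideal (MvPolynomial V K) :=
  Ideal.span {f | ∃ i j, D.Edge i j ∧ f = MvPolynomial.X i * MvPolynomial.X j ^ D.w j}

end WeightedOrientedGraph

/-- An ideal is unmixed if all its associated primes (those of the module `R ⧸ I`) have the same
height. -/
def Ideal.IsUnmixed {R : Type*} [CommRing R] (I : Ideal R) : Prop :=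
  ∀ p ∈ associatedPrimes R (R ⧸ I), ∀ q ∈ associatedPrimes R (R ⧸ I), p.height = q.height

/-- A (finite) graph is well-covered if every maximal stable set has cardinality `β(G)`, the
maximum cardinality of a stable set. -/
def SimpleGraph.IsWellCovered {V : Type*} (G : SimpleGraph V) : Prop :=
  ∀ S : Finset V, Maximal (fun T : Finset V => G.IsIndepSet (T : Set V)) S → S.card = G.indepNum

/-- `G` has no cycle of length `n`, induced or not. -/
def SimpleGraph.HasNoCycleOfLength {V : Type*} (G : SimpleGraph V) (n : ℕ) : Prop :=
  ∀ (v : V) (p : G.Walk v v), p.IsCycle → p.length ≠ n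

/-! The associated primes of I(D) are exactly the ideals generated by the strong vertex covers, and
such an ideal has height the size of the cover. So unmixedness says that all strong covers have the
same size.

Complements of maximal stable sets are strong covers, which gives (a). A strong cover containing a
vertex together with all its neighbours properly contains another strong cover, so under unmixedness
there is none. If (b) failed at `y → x`, the absence of 3- and 5-cycles would allow such a cover to
be built around `x` (`neighborCondition_of_ncard_eq`). Conversely, (b) alone excludes these covers
(`NeighborCondition.not_nbhd_subset`); every strong cover is then the complement of a maximal stable
set, and (a) equates the sizes. -/

namespace MvPolynomial

/-! ### Monomial supports and primes generated by variables -/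

variable {σ R K : Type*}

theorem exists_coeff_eq_ite [CommSemiring R] (p : (σ →₀ ℕ) → Prop) [DecidablePred p]
    (f : MvPolynomial σ R) :
    ∃ f' : MvPolynomial σ R, ∀ m, coeff m f' = if p m then coeff m f else 0 := by
  classical
  refine ⟨∑ m ∈ f.support.filter p, monomial m (coeff m f), fun m => ?_⟩
  rw [coeff_sum]
  simp only [coeff_monomial, Finset.sum_ite_eq', Finset.mem_filter, mem_support_iff]
  by_cases hp : p m <;> by_cases h0 : coeff m f = 0 <;> simp [hp, h0]

/-- If `N` is the set of monomials outside a monomial ideal generated by monomials in the variables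
from `C`, then a polynomial outside the ideal generated by these variables is regular modulo the
monomial ideal. -/
theorem exists_mem_support_mul_of_monomial [Finite σ] [CommRing R] [IsDomain R] (C : Set σ)
    (N : (σ →₀ ℕ) → Prop) (hN : ∀ a b : σ →₀ ℕ, (∀ x ∈ C, a x ≤ b x) → N b → N a)
    {f g : MvPolynomial σ R} (hg : ∃ a ∈ g.support, ∀ x ∈ C, a x = 0)
    (hf : ∃ b ∈ f.support, N b) : ∃ c ∈ (g * f).support, N c := by
  classical
  cases nonempty_fintype σ
  -- Grade by the degree in the variables from `C`. The part of `f` in `N` of least degree times the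
  -- degree-zero part of `g` is nonzero over a domain, and its monomials keep their coefficients in
  -- `g * f`.
  let deg : (σ →₀ ℕ) → ℕ := fun m => ∑ x, if x ∈ C then m x else 0
  have deg_add (a b) : deg (a + b) = deg a + deg b := by
    simp only [deg, ← Finset.sum_add_distrib]
    refine Finset.sum_congr rfl fun x _ => ?_
    split_ifs <;> simp
  have deg_eq_zero (a) : deg a = 0 ↔ ∀ x ∈ C, a x = 0 := by
    simp [deg, Finset.sum_eq_zero_iff]
  obtain ⟨b₀, hb₀, hmin⟩ := Finset.exists_min_image (f.support.filter N) deg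
    (by obtain ⟨b, hb, hNb⟩ := hf; exact ⟨b, by simpa using ⟨by simpa using hb, hNb⟩⟩)
  rw [Finset.mem_filter, mem_support_iff] at hb₀
  obtain ⟨a₀, ha₀, haC⟩ := hg
  rw [mem_support_iff] at ha₀
  obtain ⟨f', hf'⟩ := exists_coeff_eq_ite (fun m => N m ∧ deg m = deg b₀) f
  obtain ⟨g', hg'⟩ := exists_coeff_eq_ite (fun m => deg m = 0) g
  have hf0 : f' ≠ 0 := fun h => hb₀.1 (by simpa [h, hb₀.2] using (hf' b₀).symm)
  have hg0 : g' ≠ 0 := fun h =>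
    ha₀ (by simpa [h, (deg_eq_zero a₀).2 haC] using (hg' a₀).symm)
  obtain ⟨c, hc⟩ := ne_zero_iff.1 (mul_ne_zero hg0 hf0)
  have hc' := hc
  rw [coeff_mul] at hc'
  obtain ⟨⟨a, b⟩, hab, hne⟩ := Finset.exists_ne_zero_of_sum_ne_zero hc'
  rw [Finset.HasAntidiagonal.mem_antidiagonal] at hab
  have ha : deg a = 0 := by
    by_contra h
    exact hne (by simp [hg', h])
  have hb : N b ∧ deg b = deg b₀ := by
    by_contra h
    exact hne (by rw [hf', if_neg h, mul_zero])
  have hNc : N c := by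
    refine hN c b (fun x hx => ?_) hb.1
    rw [← show a + b = c from hab, Finsupp.add_apply, (deg_eq_zero a).1 ha x hx, zero_add]
  refine ⟨c, ?_, hNc⟩
  rw [mem_support_iff]
  convert hc using 1
  rw [coeff_mul, coeff_mul]
  refine Finset.sum_congr rfl fun ⟨a', b'⟩ hab' => ?_
  rw [Finset.HasAntidiagonal.mem_antidiagonal] at hab'
  change a' + b' = c at hab'
  change coeff a' g * coeff b' f = coeff a' g' * coeff b' f'
  rw [hf', hg']
  by_cases hb' : coeff b' f = 0
  · simp [hb']
  -- `N` is closed under lowering exponents, so `b'` competes in the choice of `b₀`; additivity of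
  -- the degree then leaves no slack.
  have hNb' : N b' := hN b' c (fun x _ => by rw [← hab']; simp) hNc
  have h1 : deg b₀ ≤ deg b' := hmin b' (by simp [hb', hNb'])
  have h2 : deg a' + deg b' = deg a + deg b := by
    rw [← deg_add, ← deg_add, hab', show a + b = c from hab]
  have h3 : deg a' = 0 := by omega
  have h4 : deg b' = deg b₀ := by omega
  simp [h3, h4, hNb']

theorem notMem_span_X_image [CommSemiring R] {C : Set σ} {g : MvPolynomial σ R} :
    g ∉ Ideal.span (X '' C : Set (MvPolynomial σ R)) ↔ ∃ a ∈ g.support, ∀ x ∈ C, a x = 0 := by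
  rw [mem_ideal_span_X_image]
  push Not
  rfl

theorem isPrime_span_X_image [Finite σ] [CommRing R] [IsDomain R] (C : Set σ) :
    (Ideal.span (X '' C : Set (MvPolynomial σ R))).IsPrime := by
  refine ⟨?_, fun {g f} h => ?_⟩
  · rw [Ideal.ne_top_iff_one, notMem_span_X_image]
    exact ⟨0, by simp, by simp⟩
  · by_contra! h'
    rw [notMem_span_X_image, notMem_span_X_image] at h'
    refine notMem_span_X_image.2 ?_ h
    exact exists_mem_support_mul_of_monomial C (fun m => ∀ x ∈ C, m x = 0)
      (fun a b hab hb x hx => Nat.le_zero.1 ((hab x hx).trans_eq (hb x hx))) h'.1 h'.2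

theorem X_mem_span_X_image [CommSemiring R] [Nontrivial R] {C : Set σ} {x : σ} :
    (X x : MvPolynomial σ R) ∈ Ideal.span (X '' C : Set (MvPolynomial σ R)) ↔ x ∈ C := by
  classical
  refine ⟨fun h => ?_, fun h => Ideal.subset_span ⟨x, h, rfl⟩⟩
  rw [mem_ideal_span_X_image] at h
  obtain ⟨i, hi, hne⟩ := h (Finsupp.single x 1) (by simp [mem_support_iff, coeff_X])
  rw [Finsupp.single_apply_ne_zero] at hne
  exact hne.1 ▸ hi

/-- Krull's height theorem gives the upper bound; adjoining the variables one at a time gives a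
strict chain of primes for the lower one. -/
theorem height_span_X_image [Finite σ] [Field K] (C : Set σ) :
    (Ideal.span (X '' C : Set (MvPolynomial σ K))).height = C.ncard := by
  have := isPrime_span_X_image (R := K) C
  refine le_antisymm ?_ ?_
  · refine (Ideal.height_le_card_of_mem_minimalPrimes_span (Set.toFinite (X '' C))
      (by rw [Ideal.minimalPrimes_eq_subsingleton_self]; rfl)).trans ?_
    exact_mod_cast Set.ncard_image_le (Set.toFinite C)
  · induction C, Set.toFinite C using Set.Finite.induction_on with
    | empty => simp
    | @insert a s ha hs ih =>
      have h1 := isPrime_span_X_image (R := K) s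
      rw [Set.ncard_insert_of_notMem ha hs, Nat.cast_add, Nat.cast_one]
      refine (add_le_add_left (ih h1) 1).trans (Ideal.height_add_one_le_of_lt_of_isPrime ?_)
      refine lt_of_le_not_ge (Ideal.span_mono (Set.image_mono (Set.subset_insert a s))) fun h => ha ?_
      exact X_mem_span_X_image.1 (h (X_mem_span_X_image.2 (Set.mem_insert a s)))

end MvPolynomial

/-! ### Associated primes of the edge ideal and strong vertex covers -/

namespace WeightedOrientedGraph

open MvPolynomial

variable {V : Type*} {K : Type*} [Field K] (D : WeightedOrientedGraph V)

/-- `C` contains an endpoint of every edge. -/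
def IsCover (C : Set V) : Prop := ∀ x y, D.Edge x y → x ∈ C ∨ y ∈ C

/-- A vertex cover `C` is strong if every `x ∈ C` with all its neighbours in `C` has an
in-neighbour `y ∈ C` of weight greater than one all of whose out-neighbours lie in `C`. -/
def IsStrongCover (C : Set V) : Prop :=
  D.IsCover C ∧ ∀ x ∈ C, D.nbhd x ⊆ C →
    ∃ y, D.Edge y x ∧ y ∈ C ∧ D.outNbhd y ⊆ C ∧ y ∈ D.Vplus

/-- The exponents of the monomials outside the irreducible monomial ideal attached to the vertex
cover `C`, generated by the variables `x ∈ C` with an out-neighbour outside `C` and the powers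
`x ^ w x` for the other `x ∈ C`. -/
def IsStandard (C : Set V) (m : V →₀ ℕ) : Prop :=
  ∀ x ∈ C, m x < D.w x ∧ (m x ≠ 0 → D.outNbhd x ⊆ C)

variable {D} {C : Set V}

theorem IsStandard.mono {a b : V →₀ ℕ} (hab : ∀ x ∈ C, a x ≤ b x) (hb : D.IsStandard C b) :
    D.IsStandard C a := fun x hx =>
  ⟨(hab x hx).trans_lt (hb x hx).1, fun h => (hb x hx).2 fun h0 =>
    h (Nat.le_zero.1 ((hab x hx).trans_eq h0))⟩

theorem Edge.ne {x y : V} (h : D.Edge x y) : x ≠ y := by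
  rintro rfl
  exact D.asymm _ _ h h

theorem mem_edgeIdeal {f : MvPolynomial V K} :
    f ∈ D.edgeIdeal K ↔ ∀ m ∈ f.support, ∃ i j, D.Edge i j ∧ m i ≠ 0 ∧ D.w j ≤ m j := by
  classical
  have : D.edgeIdeal K = Ideal.span ((fun s => monomial s (1 : K)) ''
      {s | ∃ i j, D.Edge i j ∧ s = Finsupp.single i 1 + Finsupp.single j (D.w j)}) := by
    rw [edgeIdeal]
    congr 1
    ext f
    simp only [Set.mem_ofPred_eq, Set.mem_image]
    constructor
    · rintro ⟨i, j, h, rfl⟩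
      exact ⟨_, ⟨i, j, h, rfl⟩, by rw [X_pow_eq_monomial, X, monomial_mul, one_mul]⟩
    · rintro ⟨_, ⟨i, j, h, rfl⟩, rfl⟩
      exact ⟨i, j, h, by rw [X_pow_eq_monomial, X, monomial_mul, one_mul]⟩
  rw [this, mem_ideal_span_monomial_image]
  refine forall₂_congr fun m _ => ⟨?_, ?_⟩
  · rintro ⟨_, ⟨i, j, h, rfl⟩, hle⟩
    have hi := hle i
    have hj := hle j
    simp only [Finsupp.add_apply, Finsupp.single_apply, if_true, if_neg h.ne, if_neg h.ne.symm]
      at hi hj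
    exact ⟨i, j, h, by omega, by omega⟩
  · rintro ⟨i, j, h, hi, hj⟩
    refine ⟨_, ⟨i, j, h, rfl⟩, fun x => ?_⟩
    rw [Finsupp.add_apply, Finsupp.single_apply, Finsupp.single_apply]
    have := h.ne
    split_ifs with h1 h2 h2
    · exact absurd (h1.trans h2.symm) this
    · subst h1; omega
    · subst h2; omega
    · omega

theorem IsCover.not_isStandard (hC : D.IsCover C) {i j : V} (h : D.Edge i j) {m : V →₀ ℕ}
    (hi : m i ≠ 0) (hj : D.w j ≤ m j) : ¬ D.IsStandard C m := by
  intro hm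
  have hjC : j ∉ C := fun hjC => absurd (hm j hjC).1 (not_lt.2 hj)
  have hiC : i ∈ C := (hC i j h).resolve_right hjC
  exact hjC ((hm i hiC).2 hi h)

/-- The decomposition of the edge ideal: a monomial outside `I(D)` is standard for some strong
vertex cover. -/
theorem exists_isStrongCover_isStandard [Finite V] {m : V →₀ ℕ}
    (hm : ∀ i j, D.Edge i j → m i ≠ 0 → ¬ D.w j ≤ m j) :
    ∃ C, D.IsStrongCover C ∧ D.IsStandard C m := by
  -- The set of `x` with `m x < w x` is a cover for which `m` is standard, since no generator
  -- divides `m`; a minimal such cover inside it is strong.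
  obtain ⟨C, -, hmin⟩ := (Set.toFinite {C | D.IsCover C ∧ D.IsStandard C m}).exists_le_minimal
    (a := {x | m x < D.w x}) ⟨fun x y h => by
      by_contra! h'
      simp only [Set.mem_ofPred_eq, not_lt] at h'
      exact hm x y h (by have := D.one_le_w x; omega) h'.2,
      fun x hx => ⟨hx, fun h0 y hy => not_le.1 (hm x y hy h0)⟩⟩
  refine ⟨C, ⟨hmin.prop.1, fun x hx hN => ?_⟩, hmin.prop.2⟩
  -- Removing `x` leaves a cover, so by minimality standardness fails at some `y`. The only possible
  -- cause is an edge `y → x` with `m y ≠ 0`, and `0 < m y < w y` puts `y` in `V⁺`.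
  have hnot : ¬ D.IsStandard (C \ {x}) m := fun h => by
    have : C ⊆ C \ {x} := hmin.le_of_le ⟨fun i j hij => ?_, h⟩ Set.sdiff_subset
    · exact (this hx).2 rfl
    · have hne := hij.ne
      rcases eq_or_ne i x with rfl | hix
      · exact .inr ⟨hN (.inl hij), hne.symm⟩
      rcases eq_or_ne j x with rfl | hjx
      · exact .inl ⟨hN (.inr hij), hne⟩
      exact (hmin.prop.1 i j hij).imp (fun h => ⟨h, hix⟩) (fun h => ⟨h, hjx⟩)
  simp only [IsStandard, not_forall] at hnot
  obtain ⟨y, hy, hny⟩ := hnot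
  have hyC := hmin.prop.2 y hy.1
  have h0 : m y ≠ 0 := fun h0 => hny ⟨hyC.1, fun h => absurd h0 h⟩
  have hout := hyC.2 h0
  refine ⟨y, ?_, hy.1, hout, ?_⟩
  · by_contra hyx
    exact hny ⟨hyC.1, fun _ z hz => ⟨hout hz, fun hzx => hyx (hzx ▸ hz)⟩⟩
  · have := hyC.1
    change 1 < D.w y
    omega

theorem mem_associatedPrimes_edgeIdeal_iff [Finite V] {P : Ideal (MvPolynomial V K)} :
    P ∈ associatedPrimes (MvPolynomial V K) (MvPolynomial V K ⧸ D.edgeIdeal K) ↔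
      P.IsPrime ∧ ∃ f, ∀ g, g ∈ P ↔ g * f ∈ D.edgeIdeal K := by
  rw [AssociatedPrimes.mem_iff, isAssociatedPrime_iff]
  refine and_congr_right fun _ => ?_
  rw [Ideal.Quotient.mk_surjective.exists]
  refine exists_congr fun f => ?_
  rw [SetLike.ext_iff]
  refine forall_congr' fun g => ?_
  rw [Submodule.mem_colon_singleton, Submodule.mem_bot,
    ← Ideal.Quotient.eq_zero_iff_mem (I := D.edgeIdeal K), map_mul]
  rfl

/-- The regularity of polynomials outside the prime ideal of a cover. -/
theorem IsCover.mul_notMem_edgeIdeal [Finite V] (hC : D.IsCover C) {f g : MvPolynomial V K}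
    (hg : g ∉ Ideal.span (X '' C : Set (MvPolynomial V K)))
    (hf : ∃ m ∈ f.support, D.IsStandard C m) : g * f ∉ D.edgeIdeal K := by
  intro h
  obtain ⟨c, hc, hstd⟩ := exists_mem_support_mul_of_monomial C (D.IsStandard C)
    (fun a b => IsStandard.mono) (notMem_span_X_image.1 hg) hf
  obtain ⟨i, j, hij, hi, hj⟩ := mem_edgeIdeal.1 h c hc
  exact hC.not_isStandard hij hi hj hstd

/-- `P` is the annihilator of `f` modulo I(D), so it lies in the prime of each strong cover for
which `f` has a standard monomial. If it equalled none of them, each such cover would have a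
variable outside `P`, and high powers of these variables would kill `f`. -/
theorem exists_isStrongCover_of_mem_associatedPrimes [Finite V] {P : Ideal (MvPolynomial V K)}
    (hP : P ∈ associatedPrimes (MvPolynomial V K) (MvPolynomial V K ⧸ D.edgeIdeal K)) :
    ∃ C, D.IsStrongCover C ∧ P = Ideal.span (X '' C) := by
  classical
  cases nonempty_fintype V
  obtain ⟨hprime, f, hf⟩ := mem_associatedPrimes_edgeIdeal_iff.1 hP
  have hle (C) (hC : D.IsStrongCover C) (hm : ∃ m ∈ f.support, D.IsStandard C m) :
      P ≤ Ideal.span (X '' C) := fun g hg => by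
    by_contra h
    exact hC.1.mul_notMem_edgeIdeal h hm ((hf g).1 hg)
  by_contra! hne
  have hex (C) (hC : D.IsStrongCover C) (hm : ∃ m ∈ f.support, D.IsStandard C m) :
      ∃ x ∈ C, X x ∉ P := by
    by_contra! h
    refine hne C hC (le_antisymm (hle C hC hm) (Ideal.span_le.2 ?_))
    rintro _ ⟨x, hx, rfl⟩
    exact h x hx
  let e : V →₀ ℕ := Finsupp.equivFunOnFinite.symm fun x => if X x ∈ P then 0 else D.w x
  have he : monomial e (1 : K) ∉ P := by
    rw [monomial_eq, C_1, one_mul, Finsupp.prod_fintype _ _ (fun i => pow_zero _),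
      hprime.prod_mem_iff]
    rintro ⟨x, -, hx⟩
    have hx' := hprime.mem_of_pow_mem _ hx
    have h0 : e x = 0 := by simp [e, hx']
    rw [h0, pow_zero] at hx
    exact hprime.ne_top ((Ideal.eq_top_iff_one _).2 hx)
  refine he ((hf _).2 (mem_edgeIdeal.2 fun m hm => ?_))
  by_contra! h
  obtain ⟨C, hC, hmC⟩ := exists_isStrongCover_isStandard (D := D) (m := m)
    fun i j hij hi => not_le.2 (h i j hij hi)
  obtain ⟨a, ha, b, hb, rfl⟩ := Finset.mem_add.1 (support_mul _ _ hm)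
  rw [Finset.mem_singleton.1 (support_monomial_subset ha)] at hmC
  obtain ⟨x, hx, hxP⟩ := hex C hC ⟨b, hb, hmC.mono fun x _ => by simp⟩
  have h1 := (hmC x hx).1
  simp [e, hxP] at h1

theorem IsStrongCover.mem_associatedPrimes [Finite V] (hC : D.IsStrongCover C) :
    Ideal.span (X '' C) ∈
      associatedPrimes (MvPolynomial V K) (MvPolynomial V K ⧸ D.edgeIdeal K) := by
  classical
  rw [mem_associatedPrimes_edgeIdeal_iff]
  -- The exponents on `C` are the largest that remain standard; outside `C`, the exponent `w x`
  -- suffices to complete every generator.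
  let e : V →₀ ℕ := Finsupp.equivFunOnFinite.symm fun x =>
    if x ∈ C then if D.outNbhd x ⊆ C then D.w x - 1 else 0 else D.w x
  have he (x) : e x = if x ∈ C then if D.outNbhd x ⊆ C then D.w x - 1 else 0 else D.w x := rfl
  have hw := D.one_le_w
  refine ⟨isPrime_span_X_image C, monomial e 1, fun g => ⟨fun hg => ?_, fun hg => ?_⟩⟩
  · suffices h : Ideal.span (X '' C) ≤ (D.edgeIdeal K).colon {monomial e (1 : K)} by
      simpa using Submodule.mem_colon_singleton.1 (h hg)
    rw [Ideal.span_le]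
    rintro _ ⟨x, hx, rfl⟩
    rw [SetLike.mem_coe, Submodule.mem_colon_singleton, smul_eq_mul, X, monomial_mul, one_mul,
      mem_edgeIdeal]
    intro m hm
    rw [Finset.mem_singleton.1 (support_monomial_subset hm)]
    simp only [Finsupp.add_apply, Finsupp.single_apply]
    by_cases hout : D.outNbhd x ⊆ C
    -- `X x` raises the exponent of `x` to `w x`, so an in-neighbour occurring in `e` is needed. One
    -- outside `C` will do; otherwise strongness supplies one in `C` with exponent `w y - 1 > 0`.
    · obtain ⟨y, hyx, hy⟩ : ∃ y, D.Edge y x ∧ e y ≠ 0 := by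
        by_cases hin : D.inNbhd x ⊆ C
        · obtain ⟨y, hyx, hyC, hyout, hy⟩ := hC.2 x hx (Set.union_subset hout hin)
          have : 1 < D.w y := hy
          exact ⟨y, hyx, by rw [he, if_pos hyC, if_pos hyout]; omega⟩
        · obtain ⟨y, hyx, hyC⟩ := Set.not_subset.1 hin
          exact ⟨y, hyx, by rw [he, if_neg hyC]; have := hw y; omega⟩
      refine ⟨y, x, hyx, by omega, ?_⟩
      rw [he, if_pos hx, if_pos hout, if_pos rfl]
      omega
    · obtain ⟨y, hxy, hyC⟩ := Set.not_subset.1 hout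
      refine ⟨x, y, hxy, by simp, ?_⟩
      rw [he, if_neg hyC]
      omega
  · by_contra h
    refine hC.1.mul_notMem_edgeIdeal h ⟨e, by simp, fun x hx => ?_⟩ hg
    rw [he, if_pos hx]
    have := hw x
    split_ifs with h
    · exact ⟨by omega, fun _ => h⟩
    · exact ⟨by omega, fun h => absurd rfl h⟩

theorem isUnmixed_edgeIdeal_iff [Finite V] :
    (D.edgeIdeal K).IsUnmixed ↔
      ∀ C C', D.IsStrongCover C → D.IsStrongCover C' → C.ncard = C'.ncard := by
  constructor
  · intro h C C' hC hC'
    have := h _ hC.mem_associatedPrimes _ hC'.mem_associatedPrimes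
    rw [height_span_X_image, height_span_X_image] at this
    exact_mod_cast this
  · intro h p hp q hq
    obtain ⟨C, hC, rfl⟩ := exists_isStrongCover_of_mem_associatedPrimes hp
    obtain ⟨C', hC', rfl⟩ := exists_isStrongCover_of_mem_associatedPrimes hq
    rw [height_span_X_image, height_span_X_image, h C C' hC hC']

end WeightedOrientedGraph

/-! ### Short cycles, maximal stable sets and well-coveredness -/

namespace SimpleGraph

variable {V : Type*} {G : SimpleGraph V}

theorem HasNoCycleOfLength.not_triangle (h : G.HasNoCycleOfLength 3) {a b c : V}
    (hab : G.Adj a b) (hbc : G.Adj b c) (hca : G.Adj c a) : False := by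
  refine h a (.cons hab (.cons hbc (.cons hca .nil))) ?_ rfl
  have := hab.ne
  have := hbc.ne
  have := hca.ne
  simp [Walk.cons_isCycle_iff, Walk.cons_isPath_iff]
  grind

/-- Even closed walks of length five are excluded: a repeated vertex would leave a triangle. -/
theorem HasNoCycleOfLength.not_pentagon (h3 : G.HasNoCycleOfLength 3)
    (h5 : G.HasNoCycleOfLength 5) {a b c d e : V} (hab : G.Adj a b) (hbc : G.Adj b c)
    (hcd : G.Adj c d) (hde : G.Adj d e) (hea : G.Adj e a) : False := by
  have hac : a ≠ c := by rintro rfl; exact h3.not_triangle hcd hde hea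
  have hbd : b ≠ d := by rintro rfl; exact h3.not_triangle hde hea hab
  have hce : c ≠ e := by rintro rfl; exact h3.not_triangle hea hab hbc
  have hda : d ≠ a := by rintro rfl; exact h3.not_triangle hab hbc hcd
  have heb : e ≠ b := by rintro rfl; exact h3.not_triangle hbc hcd hde
  refine h5 a (.cons hab (.cons hbc (.cons hcd (.cons hde (.cons hea .nil))))) ?_ rfl
  have := hab.ne
  have := hbc.ne
  have := hcd.ne
  have := hde.ne
  have := hea.ne
  simp [Walk.cons_isCycle_iff, Walk.cons_isPath_iff]
  grind

theorem isIndepSet_insert {S : Set V} {x : V} (hS : G.IsIndepSet S)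
    (hx : ∀ y ∈ S, ¬ G.Adj x y) : G.IsIndepSet (insert x S) :=
  hS.insert fun y hy _ => ⟨hx y hy, fun h => hx y hy h.symm⟩

theorem maximal_isIndepSet_iff {S : Set V} :
    Maximal G.IsIndepSet S ↔ G.IsIndepSet S ∧ ∀ x, x ∉ S → ∃ y ∈ S, G.Adj x y := by
  constructor
  · refine fun h => ⟨h.prop, fun x hx => ?_⟩
    by_contra! h'
    exact hx (h.le_of_ge (isIndepSet_insert h.prop h') (Set.subset_insert x S)
      (Set.mem_insert x S))
  · refine fun ⟨h, hS⟩ => ⟨h, fun T hT hST x hx => ?_⟩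
    by_contra hxS
    obtain ⟨y, hy, hxy⟩ := hS x hxS
    exact hT hx (hST hy) hxy.ne hxy

theorem isWellCovered_iff [Finite V] :
    G.IsWellCovered ↔ ∀ S : Set V, Maximal G.IsIndepSet S → S.ncard = G.indepNum := by
  classical
  constructor
  · intro h S hS
    lift S to Finset V using Set.toFinite S
    rw [Set.ncard_coe_finset]
    exact h S ⟨hS.prop, fun T hT hST => by exact_mod_cast hS.le_of_ge hT (by exact_mod_cast hST)⟩
  · intro h S hS
    rw [← Set.ncard_coe_finset]
    refine h S ⟨hS.prop, fun T hT hST => ?_⟩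
    lift T to Finset V using Set.toFinite T
    exact_mod_cast hS.le_of_ge hT (by exact_mod_cast hST)

theorem isWellCovered_of_ncard_eq [Finite V]
    (h : ∀ S T : Set V, Maximal G.IsIndepSet S → Maximal G.IsIndepSet T → S.ncard = T.ncard) :
    G.IsWellCovered := by
  rw [isWellCovered_iff]
  intro S hS
  obtain ⟨T, hT⟩ := G.exists_isNIndepSet_indepNum
  obtain ⟨U, hTU, hU⟩ := (Set.toFinite {T : Set V | G.IsIndepSet T}).exists_le_maximal
    (a := (T : Set V)) hT.isIndepSet
  refine le_antisymm ?_ ?_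
  · lift S to Finset V using Set.toFinite S
    rw [Set.ncard_coe_finset]
    exact hS.prop.card_le_indepNum
  · rw [h S U hS hU, ← hT.card_eq, ← Set.ncard_coe_finset]
    exact Set.ncard_le_ncard hTU

end SimpleGraph

/-! ### Strong covers and the neighbour condition -/

namespace WeightedOrientedGraph

variable {V : Type*} {D : WeightedOrientedGraph V} {C S : Set V}

theorem mem_nbhd {x y : V} : y ∈ D.nbhd x ↔ D.G.Adj x y := (D.adj_iff x y).symm

theorem Edge.adj {x y : V} (h : D.Edge x y) : D.G.Adj x y := (D.adj_iff x y).2 (.inl h)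

theorem isCover_compl_iff : D.IsCover Sᶜ ↔ D.G.IsIndepSet S := by
  constructor
  · intro h x hx y hy _ hxy
    rcases (D.adj_iff x y).1 hxy with e | e
    · exact (h x y e).elim (fun h => h hx) (fun h => h hy)
    · exact (h y x e).elim (fun h => h hy) (fun h => h hx)
  · intro h x y e
    by_contra! h'
    exact h (not_not.1 h'.1) (not_not.1 h'.2) e.ne e.adj

theorem isStrongCover_compl_of_maximal (hS : Maximal D.G.IsIndepSet S) : D.IsStrongCover Sᶜ := by
  refine ⟨isCover_compl_iff.2 hS.prop, fun x hx hN => ?_⟩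
  obtain ⟨y, hy, hxy⟩ := (SimpleGraph.maximal_isIndepSet_iff.1 hS).2 x hx
  exact absurd hy (hN (mem_nbhd.2 hxy))

theorem IsCover.maximal_isIndepSet_compl (hC : D.IsCover C) (h : ∀ x ∈ C, ¬ D.nbhd x ⊆ C) :
    Maximal D.G.IsIndepSet Cᶜ := by
  refine SimpleGraph.maximal_isIndepSet_iff.2
    ⟨isCover_compl_iff.1 (by rwa [compl_compl]), fun x hx => ?_⟩
  obtain ⟨y, hxy, hy⟩ := Set.not_subset.1 (h x (not_not.1 hx))
  exact ⟨y, hy, mem_nbhd.1 hxy⟩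

/-- If all strong vertex covers have the same cardinality, then they are minimal. -/
theorem IsStrongCover.not_nbhd_subset [Finite V] (hC : D.IsStrongCover C)
    (h : ∀ C C', D.IsStrongCover C → D.IsStrongCover C' → C.ncard = C'.ncard) {x : V}
    (hx : x ∈ C) : ¬ D.nbhd x ⊆ C := by
  intro hN
  have hind : D.G.IsIndepSet (insert x Cᶜ) :=
    SimpleGraph.isIndepSet_insert (isCover_compl_iff.1 (by rw [compl_compl]; exact hC.1))
      fun y hy hxy => hy (hN (mem_nbhd.2 hxy))
  obtain ⟨U, hU, hUmax⟩ :=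
    (Set.toFinite {T : Set V | D.G.IsIndepSet T}).exists_le_maximal hind
  have hcard := h C Uᶜ hC (isStrongCover_compl_of_maximal hUmax)
  have hlt : Uᶜ ⊂ C := by
    refine Set.ssubset_iff_subset_ne.2 ⟨fun y hy => ?_, ?_⟩
    · by_contra hyC
      exact hy (hU (.inr hyC))
    · rintro rfl
      exact hx (hU (.inl rfl))
  exact absurd (Set.ncard_lt_ncard hlt) (by omega)

/-- The local condition on the edges leaving a vertex of weight greater than one. -/
def NeighborCondition (D : WeightedOrientedGraph V) : Prop :=
  ∀ y x, D.Edge y x → y ∈ D.Vplus → ∃ y' ∈ D.nbhd x \ {y}, D.nbhd y' ⊆ D.outNbhd y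

/-- The condition at `y → x` yields `y'` whose neighbours all lie in `C`, so strongness applies
again and gives `z → y'`. The condition at `z → y'` yields a neighbour `u` of `y'`. Then `y → z` and
`y → u`, while the neighbours of `u`, among them `y`, are out-neighbours of `z`: both `y → z` and `z
→ y`. -/
theorem NeighborCondition.not_nbhd_subset (h : D.NeighborCondition) (hC : D.IsStrongCover C)
    {x : V} (hx : x ∈ C) : ¬ D.nbhd x ⊆ C := by
  intro hN
  obtain ⟨y, hyx, -, hout, hy⟩ := hC.2 x hx hN
  obtain ⟨y', ⟨hy', -⟩, hsub⟩ := h y x hyx hy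
  obtain ⟨z, hzy', -, -, hz⟩ := hC.2 y' (hN hy') (hsub.trans hout)
  obtain ⟨u, ⟨hu, -⟩, husub⟩ := h z y' hzy' hz
  exact D.asymm _ _ (hsub (.inr hzy')) (husub (.inr (hsub hu)))

theorem neighborCondition_of_ncard_eq [Finite V] (hsource : ∀ x, D.IsSource x → D.w x = 1)
    (h3 : D.G.HasNoCycleOfLength 3) (h5 : D.G.HasNoCycleOfLength 5)
    (h : ∀ C C', D.IsStrongCover C → D.IsStrongCover C' → C.ncard = C'.ncard) :
    D.NeighborCondition := by
  intro y x hyx hy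
  by_contra! hno
  obtain ⟨u, huy⟩ : ∃ u, D.Edge u y := by
    by_contra! hs
    exact absurd (hsource y (Set.eq_empty_of_forall_notMem hs)) (ne_of_gt hy)
  have hz : ∀ y', D.G.Adj x y' → y' ≠ y → ∃ z, D.G.Adj y' z ∧ ¬ D.Edge y z := by
    intro y' hxy' hne
    obtain ⟨z, hz, hz'⟩ := Set.not_subset.1 (hno y' ⟨mem_nbhd.2 hxy', hne⟩)
    exact ⟨z, mem_nbhd.1 hz, hz'⟩
  choose! z hadj hnot using hz
  -- `u` prevents `y` from having all its neighbours in the cover; the chosen `z y'` keep every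
  -- neighbour of `x` other than `y` out of the stable set.
  let S₀ : Set V := insert u {v | ∃ y', D.G.Adj x y' ∧ y' ≠ y ∧ z y' = v}
  have hS₀ : D.G.IsIndepSet S₀ := by
    refine SimpleGraph.isIndepSet_insert ?_ ?_
    · rintro _ ⟨a, hxa, hay, rfl⟩ _ ⟨b, hxb, hby, rfl⟩ - hab
      exact h3.not_pentagon h5 hxa (hadj a hxa hay) hab (hadj b hxb hby).symm hxb.symm
    · rintro _ ⟨a, hxa, hay, rfl⟩ hua
      exact h3.not_pentagon h5 hxa (hadj a hxa hay) hua.symm huy.adj hyx.adj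
  have havoid : ∀ v ∈ S₀, ¬ D.Edge y v ∧ v ≠ y := by
    rintro v (rfl | ⟨a, hxa, hay, rfl⟩)
    · exact ⟨D.asymm _ _ huy, huy.ne⟩
    · refine ⟨hnot a hxa hay, fun heq => ?_⟩
      exact h3.not_triangle hxa (heq ▸ hadj a hxa hay) hyx.adj
  -- Maximality among stable sets avoiding `y` and its out-neighbours forces any vertex with all its
  -- neighbours outside `S`, if itself outside `S`, to be an out-neighbour of `y`; so `y` witnesses
  -- strongness.
  obtain ⟨S, hS₀S, hS⟩ := (Set.toFinite
    {T : Set V | D.G.IsIndepSet T ∧ ∀ v ∈ T, ¬ D.Edge y v ∧ v ≠ y}).exists_le_maximal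
      (a := S₀) ⟨hS₀, havoid⟩
  have hstrong : D.IsStrongCover Sᶜ := by
    refine ⟨isCover_compl_iff.2 hS.prop.1, fun v hv hN => ?_⟩
    have hvy : v ≠ y := by
      rintro rfl
      exact hN (.inr huy) (hS₀S (Set.mem_insert u _))
    refine ⟨y, ?_, fun hyS => (hS.prop.2 y hyS).2 rfl, fun a ha haS => (hS.prop.2 a haS).1 ha, hy⟩
    by_contra hyv
    refine hv (hS.le_of_ge (y := insert v S) ⟨SimpleGraph.isIndepSet_insert hS.prop.1
      fun a ha hva => hN (mem_nbhd.2 hva) ha, ?_⟩ (Set.subset_insert v S) (Set.mem_insert v S))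
    rintro a (rfl | ha)
    · exact ⟨hyv, hvy⟩
    · exact hS.prop.2 a ha
  refine hstrong.not_nbhd_subset h (x := x) (fun hxS => (hS.prop.2 x hxS).1 hyx) fun a ha haS => ?_
  have hxa := mem_nbhd.1 ha
  have hay : a ≠ y := (hS.prop.2 a haS).2
  exact hS.prop.1 haS (hS₀S (.inr ⟨a, hxa, hay, rfl⟩)) (hadj a hxa hay).ne (hadj a hxa hay)

end WeightedOrientedGraph

theorem mainTheorem6 {V : Type*} [Finite V] {K : Type*} [Field K]
    (D : WeightedOrientedGraph V)
    (hsource : ∀ x, D.IsSource x → D.w x = 1)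
    (h3 : D.G.HasNoCycleOfLength 3) (h5 : D.G.HasNoCycleOfLength 5) :
    (D.edgeIdeal K).IsUnmixed ↔
      D.G.IsWellCovered ∧
        ∀ y x, D.Edge y x → y ∈ D.Vplus →
          ∃ y' ∈ D.nbhd x \ {y}, D.nbhd y' ⊆ D.outNbhd y := by
  rw [WeightedOrientedGraph.isUnmixed_edgeIdeal_iff]
  constructor
  · intro h
    refine ⟨SimpleGraph.isWellCovered_of_ncard_eq fun S T hS hT => ?_,
      WeightedOrientedGraph.neighborCondition_of_ncard_eq hsource h3 h5 h⟩
    have h1 := h _ _ (WeightedOrientedGraph.isStrongCover_compl_of_maximal hS)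
      (WeightedOrientedGraph.isStrongCover_compl_of_maximal hT)
    have h2 := Set.ncard_add_ncard_compl S
    have h4 := Set.ncard_add_ncard_compl T
    omega
  · rintro ⟨hwc, hcond : D.NeighborCondition⟩ C C' hC hC'
    have h1 := SimpleGraph.isWellCovered_iff.1 hwc _
      (hC.1.maximal_isIndepSet_compl fun x hx => hcond.not_nbhd_subset hC hx)
    have h2 := SimpleGraph.isWellCovered_iff.1 hwc _
      (hC'.1.maximal_isIndepSet_compl fun x hx => hcond.not_nbhd_subset hC' hx)
    have h4 := Set.ncard_add_ncard_compl C
    have h6 := Set.ncard_add_ncard_compl C'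
    omega
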